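/- Let $q$ be a prime power, let $\mathbb{P}^2$ be the projective plane over $\mathbb{F}_{q^2}$ with coordinates $(x:y:z)$, and let $X\subseteq\mathbb{P}^2$ be the Hermitian curve $y^qz+yz^q=x^{q+1}$ (affine equation $y^q+y=x^{q+1}$). Let $P_\infty=(0:1:0)$ be its only point at infinity and $B=X(\mathbb{F}_{q^2})\setminus\{P_\infty\}$. For integers $d>0$, $a\ge 0$, let $H^0(X,\mathcal{O}_X(d)(-aP_\infty))$ be the space of degree $d$ homogeneous forms on $X$ that vanish on the scheme $aP_\infty\subseteq X$ (the divisor $a P_\infty$ of $X$), and let $C(d,a)\subseteq\mathbb{F}_{q^2}^{B}$ be the code obtained by evaluating these forms at the points of $B$, each written as $(x:y:1)$. Let $C(d,a)^\perp$ be its dual code with respect to the standard product $v\cdot w=\sum_{P\in B}v_Pw_P$. Let $1\le d\le q-1$ and $0\le a\le d$. Let $\delta$ be the minimum distance of $C(d,a)^\perp$ and let $A_\delta$ be the number of its minimum-weight codewords, that is, of the nonzero codewords of Hamming weight $\delta$. 1. If $a=0$, then $\delta=d+2$. A subset $S\subseteq B$ is the support of a minimum-weight codeword of $C(d,a)^\perp$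 if and only if $|S|=\delta$ and the points of $S$ are collinear in $\mathbb{P}^2$. Moreover, $$\frac{A_\delta}{q^2-1}=\begin{cases} q^4-q^3 & \text{if } d=q-1,\\[2pt] q^2\binom{q}{\delta}+(q^4-q^3)\binom{q+1}{\delta} & \text{if } d<q-1.\end{cases}$$ 2. If $a>0$, then $\delta=d+1$. A subset $S\subseteq B$ is the support of a minimum-weight codeword of $C(d,a)^\perp$ if and only if $|S|=\delta$ and the points of $\{P_\infty\}\cup S$ are collinear in $\mathbb{P}^2$. Moreover, $$\frac{A_\delta}{q^2-1}=q^2\binom{q}{\delta}.$$ -/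

import Mathlib

open scoped LinearAlgebra.Projectivization

/-! ### Linear codes of length `n = |ι|` over a field -/

namespace LinCode

variable {ι K : Type*} [Fintype ι] [Field K]

/-- The dual code `C^⊥ = {v | v · c = 0 for all c ∈ C}`. -/
def dual (C : Submodule K (ι → K)) : Submodule K (ι → K) where
  carrier := {v | ∀ c ∈ C, ∑ i, v i * c i = 0}
  zero_mem' := by
    intro c _
    simp
  add_mem' := by
    intro v w hv hw c hc
    simp only [Pi.add_apply, add_mul, Finset.sum_add_distrib, hv c hc, hw c hc, add_zero]
  smul_mem' := by
    intro r v hv c hc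
    simp only [Pi.smul_apply, smul_eq_mul, mul_assoc, ← Finset.mul_sum, hv c hc, mul_zero]

variable [DecidableEq K]

/-- The minimum distance of a code: the least Hamming distance between two distinct codewords
(`⊤` for the zero code). -/
noncomputable def minDist (C : Submodule K (ι → K)) : ℕ∞ :=
  ⨅ (v ∈ C) (w ∈ C) (_ : v ≠ w), (hammingDist v w : ℕ∞)

/-- A minimum-weight codeword: a nonzero codeword whose weight is the minimum distance. -/
def IsMinWeight (C : Submodule K (ι → K)) (v : ι → K) : Prop :=
  v ∈ C ∧ v ≠ 0 ∧ (hammingNorm v : ℕ∞) = minDist C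

/-- `S` is the support of a minimum-weight codeword of `C`. -/
def IsMinWeightSupport (C : Submodule K (ι → K)) (S : Finset ι) : Prop :=
  ∃ v, IsMinWeight C v ∧ Function.support v = (S : Set ι)

/-- The number of minimum-weight codewords of `C`. -/
noncomputable def numMinWeight (C : Submodule K (ι → K)) : ℕ :=
  {v : ι → K | IsMinWeight C v}.ncard

end LinCode

/-! ### The Hermitian curve and the codes `C(d,a)`

Homogeneous coordinates `(x : y : z)` of the plane are indexed by `0, 1, 2 : Fin 3`. -/

namespace Hermitian

open MvPolynomial

variable (K : Type*) [Field K] (q : ℕ)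

/-- The form `y^q z + y z^q - x^(q+1)`, whose affine equation (`z = 1`) is
`y^q + y = x^(q+1)`. -/
noncomputable def curveForm : MvPolynomial (Fin 3) K :=
  X 1 ^ q * X 2 + X 1 * X 2 ^ q - X 0 ^ (q + 1)

/-- The `K`-rational points of the Hermitian curve in the projective plane over `K`. -/
def rationalPoints : Set (ℙ K (Fin 3 → K)) :=
  {P | eval P.rep (curveForm K q) = 0}

/-- The point `(0 : 1 : 0)`. -/
noncomputable def pInfty : ℙ K (Fin 3 → K) :=
  Projectivization.mk K ![0, 1, 0] (fun h => one_ne_zero (congrFun h 1))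

/-- The set `B` of all rational points of the curve other than the point at infinity. -/
def affinePoints : Set (ℙ K (Fin 3 → K)) :=
  rationalPoints K q \ {pInfty K}

noncomputable instance [Fintype K] : Fintype (affinePoints K q) :=
  Fintype.ofFinite _

/-- Dehomogenization in the chart `y ≠ 0`, which contains `(0 : 1 : 0)` as its origin:
`f ↦ f(x, 1, z)`, where `x, z` are the variables `0, 1 : Fin 2`. -/
noncomputable def dehomog : MvPolynomial (Fin 3) K →ₐ[K] MvPolynomial (Fin 2) K :=
  aeval ![X 0, 1, X 1]

/-- The affine coordinate ring of the part of the curve in the chart `y ≠ 0`. -/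
abbrev ChartRing : Type _ :=
  MvPolynomial (Fin 2) K ⧸ Ideal.span {dehomog K (curveForm K q)}

/-- Restriction of a form to the curve in the chart `y ≠ 0`. -/
noncomputable def toChart : MvPolynomial (Fin 3) K →ₐ[K] ChartRing K q :=
  (Ideal.Quotient.mkₐ K (Ideal.span {dehomog K (curveForm K q)})).comp (dehomog K)

/-- The maximal ideal `(x, z)` of the point `(0 : 1 : 0)` in the coordinate ring of the chart.
As the curve is smooth there, its `a`-th power is the ideal of the divisor `a • P_∞`, seen as a
closed subscheme of the curve. -/
noncomputable def idealPInfty : Ideal (ChartRing K q) :=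
  Ideal.span {Ideal.Quotient.mk _ (X 0), Ideal.Quotient.mk _ (X 1)}

/-- Forms of degree `d` whose restriction to the curve vanishes on the scheme `a • P_∞`; their
restrictions to the curve are the elements of `H⁰(X, 𝒪_X(d)(-a P_∞))`. -/
noncomputable def sections (d a : ℕ) : Submodule K (MvPolynomial (Fin 3) K) :=
  homogeneousSubmodule (Fin 3) K d ⊓
    ((idealPInfty K q ^ a).restrictScalars K).comap (toChart K q).toLinearMap

/-- The representative of a point with last coordinate `1` (for points off the line `z = 0`,
hence for all points of `B`). -/
noncomputable def affineRep (P : ℙ K (Fin 3 → K)) : Fin 3 → K :=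
  (P.rep 2)⁻¹ • P.rep

/-- Evaluation at the points of `B`, each represented by `(x, y, 1)`. -/
noncomputable def evalMap : MvPolynomial (Fin 3) K →ₗ[K] (affinePoints K q → K) :=
  LinearMap.pi fun P => (aeval (affineRep K P.1)).toLinearMap

/-- The code `C(d,a)` obtained by evaluating `H⁰(X, 𝒪_X(d)(-a P_∞))` on `B`. -/
noncomputable def code (d a : ℕ) : Submodule K (affinePoints K q → K) :=
  (sections K q d a).map (evalMap K q)

end Hermitian

/-! A word of the dual code is a linear relation between the values of the sections at the points of
its support. Such a relation is impossible if some section vanishes at all points of the support but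
one.

Lower bound. Any `e` points can be separated from a further one by a product of `e` lines, so if all
forms of degree `e` are available, the weight is at least `e + 2`. For `a = 0` take `e = d`. For `a
> 0` take `e = d - 1` and multiply by `z`: this is `1` on `B` and vanishes at `P_∞` to order at
least `q ≥ a`. In weight exactly `e + 2`, a non-collinear support is excluded because one line
disposes of two points at once (`exists_form_of_not_collinear`). For `a > 0`, a support on a line
missing `P_∞` is excluded by a product of `d` lines through `P_∞` (`vertical_of_mem_dual`).

Existence. On a line a form of degree `d` is a polynomial in a parameter `t` of degree at most `d`,
so its divided difference on `d + 2` points is zero, a relation with no zero coefficient. On a line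
through `P_∞` the coefficient of `t ^ d` is the value at `P_∞`; if that is zero, `d + 1` points
suffice (`exists_mem_dual_of_param`).

Counting. Words of minimum weight with equal support are proportional, so supports are counted. A
support has at least two points, hence determines its line. A vertical line has `q` points in `B`; a
slanted one has `1` or `q + 1`, by counting solutions of a norm equation. -/

/-! ### Counting solutions of the trace and norm equations -/

/-- If `f` maps `s` to `t`, its fibres have at most `n` elements, and `s` has the largest
cardinality this allows, then all fibres have exactly `n` elements. -/
theorem Finset.card_fiber_eq_of_card_le {α β : Type*} [DecidableEq β] {s : Finset α}
    {t : Finset β} {f : α → β} {n m : ℕ} (hf : ∀ x ∈ s, f x ∈ t)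
    (hn : ∀ b ∈ t, (s.filter fun x => f x = b).card ≤ n) (ht : t.card ≤ m)
    (hs : s.card = n * m) {b : β} (hb : b ∈ t) : (s.filter fun x => f x = b).card = n := by
  refine le_antisymm (hn b hb) ?_
  by_contra! hlt
  have h1 := Finset.card_eq_sum_card_fiberwise (s := s) (t := t) (f := f) hf
  have h2 : ∑ b ∈ t, (s.filter fun x => f x = b).card < ∑ _b ∈ t, n :=
    Finset.sum_lt_sum hn ⟨b, hb, hlt⟩
  rw [← h1, Finset.sum_const, smul_eq_mul, hs, mul_comm] at h2
  exact absurd h2 (not_lt.mpr (Nat.mul_le_mul_right n ht))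

theorem Polynomial.card_filter_eval_eq_zero_le {K : Type*} [Field K] [Fintype K] [DecidableEq K]
    {p : Polynomial K} (hp : p ≠ 0) :
    (Finset.univ.filter fun x => p.eval x = 0).card ≤ p.natDegree := by
  apply Polynomial.card_le_degree_of_subset_roots
  intro x hx
  have hx' : p.eval x = 0 := by simpa using hx
  exact (Polynomial.mem_roots hp).2 hx'

namespace Hermitian

section Field

variable {K : Type*} [Field K] [Fintype K] {q : ℕ}

theorem pow_sq_eq_self (hK : Fintype.card K = q ^ 2) (x : K) : (x ^ q) ^ q = x := by
  rw [← pow_mul, ← sq, ← hK, FiniteField.pow_card]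

theorem add_pow_eq (hq : IsPrimePow q) (hK : Fintype.card K = q ^ 2) (x y : K) :
    (x + y) ^ q = x ^ q + y ^ q := by
  obtain ⟨p, n, hp, hn, rfl⟩ := hq
  have hp' : p.Prime := hp.nat_prime
  have := Fact.mk hp'
  have : CharP K p := by
    obtain ⟨r, hr⟩ := CharP.exists K
    obtain ⟨m, hrp, hm⟩ := FiniteField.card K r
    have : r ∣ p := by
      have h1 : r ∣ (p ^ n) ^ 2 := by
        rw [← hK, hm]; exact dvd_pow_self r m.ne_zero
      exact hrp.dvd_of_dvd_pow (hrp.dvd_of_dvd_pow h1)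
    have : r = p := (Nat.prime_dvd_prime_iff_eq hrp hp').1 this
    exact this ▸ hr
  exact add_pow_char_pow x y p n

theorem neg_pow_eq (hq : IsPrimePow q) (hK : Fintype.card K = q ^ 2) (x : K) :
    (-x) ^ q = -x ^ q := by
  have := add_pow_eq hq hK x (-x)
  rw [add_neg_cancel, zero_pow hq.pos.ne'] at this
  exact (neg_eq_of_add_eq_zero_right this.symm).symm

theorem sub_pow_eq (hq : IsPrimePow q) (hK : Fintype.card K = q ^ 2) (x y : K) :
    (x - y) ^ q = x ^ q - y ^ q := by
  rw [sub_eq_add_neg, add_pow_eq hq hK, neg_pow_eq hq hK, sub_eq_add_neg]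

theorem trace_pow_eq (hq : IsPrimePow q) (hK : Fintype.card K = q ^ 2) (x : K) :
    (x ^ q + x) ^ q = x ^ q + x := by
  rw [add_pow_eq hq hK, pow_sq_eq_self hK, add_comm]

theorem norm_pow_eq (hK : Fintype.card K = q ^ 2) (x : K) :
    (x ^ (q + 1)) ^ q = x ^ (q + 1) := by
  rw [pow_succ, mul_pow, pow_sq_eq_self hK, mul_comm]

variable [DecidableEq K]

theorem card_fixed_le (hq : IsPrimePow q) :
    (Finset.univ.filter fun e : K => e ^ q = e).card ≤ q := by
  have hq2 := hq.two_le
  have hdeg : (Polynomial.X ^ q - Polynomial.X : Polynomial K).natDegree = q :=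
    FiniteField.X_pow_card_sub_X_natDegree_eq K hq.two_le
  have h := Polynomial.card_filter_eval_eq_zero_le
    (p := (Polynomial.X ^ q - Polynomial.X : Polynomial K))
    (FiniteField.X_pow_card_sub_X_ne_zero K hq.two_le)
  rw [hdeg] at h
  simpa [sub_eq_zero] using h

/-- Pigeonhole replaces an explicit solution: the `q * q` elements of `K` are sent to at most `q`
values fixed by the `q`-th power map, each taken at most `q` times because the equation has degree
`q`. -/
theorem card_trace_fiber (hq : IsPrimePow q) (hK : Fintype.card K = q ^ 2) {e : K}
    (he : e ^ q = e) : (Finset.univ.filter fun y : K => y ^ q + y = e).card = q := by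
  have hq2 := hq.two_le
  refine Finset.card_fiber_eq_of_card_le (s := Finset.univ)
    (t := Finset.univ.filter fun e : K => e ^ q = e) (m := q) ?_ ?_ (card_fixed_le hq) ?_ ?_
  · intro x _
    simpa using trace_pow_eq hq hK x
  · intro b _
    have hdeg : (Polynomial.X ^ q + (Polynomial.X - Polynomial.C b) : Polynomial K).natDegree
        = q := by
      rw [Polynomial.natDegree_add_eq_left_of_natDegree_lt, Polynomial.natDegree_X_pow]
      rw [Polynomial.natDegree_X_pow, Polynomial.natDegree_X_sub_C]
      omega
    have h := Polynomial.card_filter_eval_eq_zero_le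
      (p := (Polynomial.X ^ q + (Polynomial.X - Polynomial.C b) : Polynomial K))
      (fun h0 => by rw [h0, Polynomial.natDegree_zero] at hdeg; omega)
    rw [hdeg] at h
    simpa [← add_sub_assoc, sub_eq_zero] using h
  · rw [Finset.card_univ, hK, sq]
  · simpa using he

/-- The same pigeonhole on nonzero elements, with `q ^ 2 - 1 = (q + 1) * (q - 1)`. -/
theorem card_norm_fiber (hq : IsPrimePow q) (hK : Fintype.card K = q ^ 2) {e : K}
    (he : e ^ q = e) (he0 : e ≠ 0) :
    (Finset.univ.filter fun x : K => x ^ (q + 1) = e).card = q + 1 := by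
  have hq2 := hq.two_le
  have key := Finset.card_fiber_eq_of_card_le (s := Finset.univ.erase (0 : K))
    (t := (Finset.univ.filter fun e : K => e ^ q = e).erase 0) (m := q - 1) (n := q + 1)
    (f := fun x : K => x ^ (q + 1)) (b := e) ?_ ?_ ?_ ?_ ?_
  · refine Eq.trans (congrArg Finset.card ?_) key
    ext x
    simp only [Finset.mem_filter, Finset.mem_univ, true_and, Finset.mem_erase, ne_eq, and_true]
    refine ⟨fun h => ⟨?_, h⟩, fun h => h.2⟩
    rintro rfl
    exact he0 (by rw [← h, zero_pow (Nat.succ_ne_zero q)])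
  · intro x hx
    have hx' : x ≠ 0 := by simpa using hx
    simp only [Finset.mem_erase, Finset.mem_filter, Finset.mem_univ, true_and]
    exact ⟨pow_ne_zero _ hx', norm_pow_eq hK x⟩
  · intro b _
    have h := Polynomial.card_filter_eval_eq_zero_le
      (p := (Polynomial.X ^ (q + 1) - Polynomial.C b : Polynomial K))
      (Polynomial.X_pow_sub_C_ne_zero (Nat.succ_pos q) b)
    rw [Polynomial.natDegree_X_pow_sub_C] at h
    refine (Finset.card_le_card ?_).trans h
    intro x hx
    simp only [Finset.mem_filter, Finset.mem_erase, Finset.mem_univ] at hx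
    simp [hx.2]
  · rw [Finset.card_erase_of_mem (by simp [hq.pos.ne'])]
    exact Nat.sub_le_sub_right (card_fixed_le hq) 1
  · rw [Finset.card_erase_of_mem (Finset.mem_univ _), Finset.card_univ, hK]
    obtain ⟨k, rfl⟩ := Nat.exists_eq_add_of_le hq2
    simp only [show 2 + k - 1 = k + 1 by omega]
    rw [Nat.sub_eq_iff_eq_add (by nlinarith)]
    ring
  · simpa using ⟨he0, he⟩

end Field

end Hermitian

/-! ### Minimum-weight codewords of a linear code -/

namespace LinCode

variable {ι K : Type*} [Fintype ι] [Field K]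

/-- If some codeword of `C` is nonzero at exactly one point of the support of `v`, then `v` is
not in the dual of `C`. -/
theorem notMem_dual {C : Submodule K (ι → K)} {v c : ι → K} (hc : c ∈ C) {i : ι} (hvi : v i ≠ 0)
    (hci : c i ≠ 0) (h : ∀ j, j ≠ i → v j ≠ 0 → c j = 0) : v ∉ dual C := by
  intro hv
  have h0 : ∑ j, v j * c j = 0 := hv c hc
  rw [Finset.sum_eq_single i] at h0
  · exact mul_ne_zero hvi hci h0
  · intro j _ hj
    by_cases hvj : v j = 0
    · rw [hvj, zero_mul]
    · rw [h j hj hvj, mul_zero]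
  · simp

/-- Points of `S` are parametrized by `t`, and all codewords restrict to `S` as polynomials in
`t` of degree less than `|S| - 1`: then `S` is the support of a codeword of the dual. -/
theorem exists_mem_dual_support_eq {C : Submodule K (ι → K)} {S : Finset ι} {t : ι → K}
    (ht : Set.InjOn t S) (h : ∀ c ∈ C, ∃ F : Polynomial K, F.degree < S.card ∧
      F.coeff (S.card - 1) = 0 ∧ ∀ i ∈ S, F.eval (t i) = c i) :
    ∃ v ∈ dual C, Function.support v = (S : Set ι) := by
  classical
  -- The nodal weights are the coefficients of the divided difference, which computes the
  -- coefficient of degree `|S| - 1` of the interpolating polynomial.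
  refine ⟨fun i => if i ∈ S then Lagrange.nodalWeight S t i else 0, ?_, ?_⟩
  · intro c hc
    obtain ⟨F, hdeg, hF, hev⟩ := h c hc
    rw [Lagrange.coeff_eq_sum ht hdeg] at hF
    simp only [ite_mul, zero_mul, Finset.sum_ite_mem, Finset.univ_inter]
    rw [← hF]
    refine Finset.sum_congr rfl fun i hi => ?_
    rw [hev i hi, Lagrange.nodalWeight, Finset.prod_inv_distrib, div_eq_mul_inv, mul_comm]
  · ext i
    by_cases hi : i ∈ S
    · simpa [hi] using Lagrange.nodalWeight_ne_zero ht hi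
    · simp [hi]

variable [DecidableEq K]

theorem support_toFinset [DecidableEq ι] (v : ι → K) :
    Function.support v = ((Finset.univ.filter fun i => v i ≠ 0 : Finset ι) : Set ι) := by
  ext i
  simp

theorem hammingNorm_eq_card_of_support_eq {v : ι → K} {S : Finset ι}
    (h : Function.support v = (S : Set ι)) : hammingNorm v = S.card := by
  have : (Finset.univ.filter fun i => v i ≠ 0 : Finset ι) = S := by
    ext i
    simpa using Set.ext_iff.1 h i
  rw [hammingNorm, this]

theorem minDist_eq_of_forall_le {D : Submodule K (ι → K)} {δ : ℕ}
    (hle : ∀ v ∈ D, v ≠ 0 → δ ≤ hammingNorm v) (hex : ∃ v ∈ D, v ≠ 0 ∧ hammingNorm v = δ) :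
    minDist D = (δ : ℕ∞) := by
  apply le_antisymm
  · obtain ⟨v, hv, hv0, rfl⟩ := hex
    refine (iInf₂_le v hv).trans ((iInf₂_le 0 D.zero_mem).trans ((iInf_le _ hv0).trans ?_))
    rw [hammingDist_zero_right]
  · refine le_iInf₂ fun v hv => le_iInf₂ fun w hw => le_iInf fun hvw => ?_
    rw [hammingDist_eq_hammingNorm]
    exact_mod_cast hle _ (D.add_mem (D.neg_mem hv) hw)
      (fun h => hvw (neg_add_eq_zero.1 h))

theorem isMinWeight_smul {D : Submodule K (ι → K)} {v : ι → K} (hv : IsMinWeight D v) {r : K}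
    (hr : r ≠ 0) : IsMinWeight D (r • v) := by
  refine ⟨D.smul_mem r hv.1, smul_ne_zero hr hv.2.1, ?_⟩
  rw [hammingNorm_smul (fun _ => (IsSMulRegular.of_ne_zero hr)), hv.2.2]

/-- Minimum-weight codewords with the same support are proportional. -/
theorem exists_smul_eq_of_support_eq {D : Submodule K (ι → K)} {v w : ι → K}
    (hv : IsMinWeight D v) (hw : IsMinWeight D w)
    (h : Function.support v = Function.support w) : ∃ r : K, r ≠ 0 ∧ w = r • v := by
  classical
  obtain ⟨i, hi⟩ := Function.ne_iff.1 hv.2.1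
  have hi : v i ≠ 0 := hi
  have hwi : w i ≠ 0 := by
    have : i ∈ Function.support w := h ▸ hi
    exact this
  refine ⟨w i / v i, div_ne_zero hwi hi, ?_⟩
  by_contra hne
  -- `u` agrees with `w` at `i`, so if `u ≠ w`, their distance is less than the minimum: the
  -- difference is supported in the common support without `i`.
  set u := (w i / v i) • v with hu
  have hui : u i = w i := by simp [hu, hi]
  have hlt : hammingDist w u < hammingNorm w := by
    refine Finset.card_lt_card (Finset.ssubset_iff_subset_ne.2 ⟨?_, ?_⟩)
    · intro j hj
      simp only [Finset.mem_filter, Finset.mem_univ, true_and] at hj ⊢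
      intro hwj
      have hvj : v j = 0 := by
        by_contra hvj
        have : j ∈ Function.support w := h ▸ (hvj : j ∈ Function.support v)
        exact this hwj
      exact hj (by simp [hu, hwj, hvj])
    · intro heq
      have : i ∈ (Finset.univ.filter fun j => w j ≠ u j : Finset ι) := by
        rw [heq]
        simpa using hwi
      simp [hui] at this
  have hle : minDist D ≤ (hammingDist w u : ℕ∞) :=
    (iInf₂_le w hw.1).trans ((iInf₂_le u (D.smul_mem _ hv.1)).trans (iInf_le _ hne))
  rw [← hw.2.2] at hle
  exact absurd (by exact_mod_cast hle) (not_le.mpr hlt)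

/-- Each support carries `|K| - 1` minimum-weight codewords. -/
theorem numMinWeight_eq_mul [Fintype K] (D : Submodule K (ι → K)) :
    numMinWeight D = {S : Finset ι | IsMinWeightSupport D S}.ncard * (Fintype.card K - 1) := by
  classical
  -- Every word of minimum weight is a unique nonzero multiple of the word `g S` chosen for its
  -- support `S`.
  choose! g hg using fun (S : Finset ι) (hS : IsMinWeightSupport D S) => hS
  have hinj : Set.InjOn (fun p : Finset ι × K => p.2 • g p.1)
      ({S : Finset ι | IsMinWeightSupport D S} ×ˢ {r : K | r ≠ 0}) := by
    rintro ⟨S, r⟩ ⟨hS, hr⟩ ⟨T, s⟩ ⟨hT, hs⟩ heq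
    simp only [Set.mem_ofPred_eq] at hS hr hT hs
    simp only at heq
    have hST : S = T := by
      rw [← Finset.coe_inj, ← (hg S hS).2, ← (hg T hT).2,
        ← Function.support_const_smul_of_ne_zero r (g S) hr, heq,
        Function.support_const_smul_of_ne_zero s (g T) hs]
    subst hST
    exact Prod.ext rfl (smul_left_injective K (hg S hS).1.2.1 heq)
  have himg : {v : ι → K | IsMinWeight D v} = (fun p : Finset ι × K => p.2 • g p.1) ''
      ({S : Finset ι | IsMinWeightSupport D S} ×ˢ {r : K | r ≠ 0}) := by
    ext v
    constructor
    · intro hv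
      have hS : IsMinWeightSupport D (Finset.univ.filter fun i => v i ≠ 0 : Finset ι) :=
        ⟨v, hv, support_toFinset v⟩
      obtain ⟨r, hr, hr'⟩ := exists_smul_eq_of_support_eq (hg _ hS).1 hv
        ((hg _ hS).2.trans (support_toFinset v).symm)
      exact ⟨(_, r), ⟨hS, hr⟩, hr'.symm⟩
    · rintro ⟨⟨S, r⟩, ⟨hS, hr⟩, rfl⟩
      exact isMinWeight_smul (hg S hS).1 hr
  have hcard : {r : K | r ≠ 0}.ncard = Fintype.card K - 1 := by
    rw [show {r : K | r ≠ 0} = ((Finset.univ.erase 0 : Finset K) : Set K) by ext; simp,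
      Set.ncard_coe_finset, Finset.card_erase_of_mem (Finset.mem_univ _), Finset.card_univ]
  rw [numMinWeight, himg, hinj.ncard_image, Set.ncard_prod, hcard]

/-- A criterion that determines the minimum distance and the supports of minimum-weight
codewords. -/
theorem minDist_and_isMinWeightSupport {D : Submodule K (ι → K)} {δ : ℕ} (hδ : 0 < δ)
    {p : Finset ι → Prop} (hle : ∀ v ∈ D, v ≠ 0 → δ ≤ hammingNorm v)
    (hp : ∀ v ∈ D, ∀ S : Finset ι, Function.support v = (S : Set ι) → S.card = δ → p S)
    (hex : ∀ S : Finset ι, S.card = δ → p S → ∃ v ∈ D, Function.support v = (S : Set ι))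
    (hne : ∃ S : Finset ι, S.card = δ ∧ p S) :
    minDist D = (δ : ℕ∞) ∧ ∀ S, IsMinWeightSupport D S ↔ S.card = δ ∧ p S := by
  have hne0 : ∀ {v : ι → K} {S : Finset ι}, Function.support v = (S : Set ι) → S.card = δ →
      v ≠ 0 := by
    rintro v S hS hc rfl
    have := hammingNorm_eq_card_of_support_eq hS
    rw [hammingNorm_zero] at this
    omega
  have hmin : minDist D = (δ : ℕ∞) := by
    obtain ⟨S, hS, hpS⟩ := hne
    obtain ⟨v, hv, hvS⟩ := hex S hS hpS
    exact minDist_eq_of_forall_le hle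
      ⟨v, hv, hne0 hvS hS, (hammingNorm_eq_card_of_support_eq hvS).trans hS⟩
  refine ⟨hmin, fun S => ⟨?_, ?_⟩⟩
  · rintro ⟨v, ⟨hv, -, hvw⟩, hvS⟩
    rw [hmin, hammingNorm_eq_card_of_support_eq hvS] at hvw
    have hc : S.card = δ := by exact_mod_cast hvw
    exact ⟨hc, hp v hv S hvS hc⟩
  · rintro ⟨hc, hpS⟩
    obtain ⟨v, hv, hvS⟩ := hex S hc hpS
    refine ⟨v, ⟨hv, hne0 hvS hc, ?_⟩, hvS⟩
    rw [hmin, hammingNorm_eq_card_of_support_eq hvS, hc]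

end LinCode

/-! ### Collinear sets in the projective plane -/

/-- A subspace of `K³` of dimension at most two lies in the kernel of a nonzero functional, and such
a kernel has dimension two. -/
theorem Projectivization.isCollinear_iff_exists_linear {K : Type*} [Field K]
    {T : Set (ℙ K (Fin 3 → K))} :
    Projectivization.IsCollinear T ↔ ∃ l : Fin 3 → K, l ≠ 0 ∧ ∀ P ∈ T, l ⬝ᵥ P.rep = 0 := by
  constructor
  · rintro ⟨M, hfin, hM, hT⟩
    have hlt : M.submodule < ⊤ := by
      refine Submodule.lt_top_of_finrank_lt_finrank ?_
      rw [Module.finrank_fin_fun]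
      omega
    obtain ⟨φ, hφ, hle⟩ := Submodule.exists_le_ker_of_lt_top _ hlt
    obtain ⟨l, rfl⟩ := (dotProductEquiv K (Fin 3)).surjective φ
    refine ⟨l, fun h => hφ (by rw [h, map_zero]), fun P hP => ?_⟩
    have h1 : P ∈ M := hT hP
    have h2 : P.rep ∈ M.submodule := by
      rw [← P.mk_rep] at h1
      exact (Projectivization.Subspace.mem_submodule_iff M P.rep_nonzero).2 h1
    exact LinearMap.mem_ker.1 (hle h2)
  · rintro ⟨l, hl, h⟩
    set φ := dotProductEquiv K (Fin 3) l with hφ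
    have hφ0 : φ ≠ 0 := by simpa [hφ] using hl
    refine ⟨(LinearMap.ker φ).projectivization, ?_, ?_, ?_⟩
    · infer_instance
    · rw [Projectivization.Subspace.submodule.apply_symm_apply]
      have := Module.Dual.finrank_ker_add_one_of_ne_zero (f := φ) hφ0
      rw [Module.finrank_fin_fun] at this
      omega
    · intro P hP
      have : P.rep ∈ LinearMap.ker φ := h P hP
      rw [← P.mk_rep]
      exact (Submodule.mk_mem_projectivization_iff _ P.rep_nonzero).2 this

namespace Hermitian

open MvPolynomial

/-! ### Affine coordinates on `B` and lines of the affine plane -/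

section Points

variable {K : Type*} [Field K] {q : ℕ}

theorem eval_curveForm (v : Fin 3 → K) :
    eval v (curveForm K q) = v 1 ^ q * v 2 + v 1 * v 2 ^ q - v 0 ^ (q + 1) := by
  simp [curveForm]

theorem eval_curveForm_smul (r : K) (v : Fin 3 → K) :
    eval (r • v) (curveForm K q) = r ^ (q + 1) * eval v (curveForm K q) := by
  simp only [eval_curveForm, Pi.smul_apply, smul_eq_mul]
  ring

/-- The affine coordinate `x` of a point of `B`. -/
noncomputable def xCoord (P : affinePoints K q) : K := affineRep K P.1 0

/-- The affine coordinate `y` of a point of `B`. -/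
noncomputable def yCoord (P : affinePoints K q) : K := affineRep K P.1 1

/-- Setting `z = 0` in the curve equation leaves `x ^ (q + 1) = 0`, so the line at infinity meets
the curve only in `P_∞`. -/
theorem rep_two_ne_zero (hq : q ≠ 0) (P : affinePoints K q) : P.1.rep 2 ≠ 0 := by
  intro h2
  have h : eval P.1.rep (curveForm K q) = 0 := P.2.1
  rw [eval_curveForm, h2, mul_zero, zero_pow hq, mul_zero, add_zero, zero_sub, neg_eq_zero] at h
  have h0 : P.1.rep 0 = 0 := pow_eq_zero_iff (Nat.succ_ne_zero q) |>.1 h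
  apply P.2.2
  change P.1 = _
  rw [← P.1.mk_rep, pInfty, Projectivization.mk_eq_mk_iff']
  refine ⟨P.1.rep 1, ?_⟩
  ext i
  fin_cases i <;> simp [h0, h2]

theorem affineRep_eq (hq : q ≠ 0) (P : affinePoints K q) :
    affineRep K P.1 = ![xCoord P, yCoord P, 1] := by
  ext i
  fin_cases i
  · rfl
  · rfl
  · simp [affineRep, rep_two_ne_zero hq P]

theorem rep_eq (hq : q ≠ 0) (P : affinePoints K q) :
    P.1.rep = P.1.rep 2 • ![xCoord P, yCoord P, 1] := by
  rw [← affineRep_eq hq, affineRep, smul_smul, mul_inv_cancel₀ (rep_two_ne_zero hq P), one_smul]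

theorem curve_equation (hq : q ≠ 0) (P : affinePoints K q) :
    yCoord P ^ q + yCoord P = xCoord P ^ (q + 1) := by
  have h : eval P.1.rep (curveForm K q) = 0 := P.2.1
  rw [rep_eq hq, eval_curveForm_smul, eval_curveForm] at h
  have := (mul_eq_zero.1 h).resolve_left (pow_ne_zero _ (rep_two_ne_zero hq P))
  simpa [sub_eq_zero] using this

theorem eq_of_coords_eq (hq : q ≠ 0) {P Q : affinePoints K q} (hx : xCoord P = xCoord Q)
    (hy : yCoord P = yCoord Q) : P = Q := by
  apply Subtype.ext
  rw [← P.1.mk_rep, ← Q.1.mk_rep, Projectivization.mk_eq_mk_iff']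
  refine ⟨P.1.rep 2 * (Q.1.rep 2)⁻¹, ?_⟩
  rw [rep_eq hq P, rep_eq hq Q, smul_smul, hx, hy]
  simp [rep_two_ne_zero hq Q]

theorem exists_point {x y : K} (h : y ^ q + y = x ^ (q + 1)) :
    ∃ P : affinePoints K q, xCoord P = x ∧ yCoord P = y := by
  have hv : (![x, y, 1] : Fin 3 → K) ≠ 0 := fun h => one_ne_zero (congrFun h 2)
  obtain ⟨r, hr⟩ := Projectivization.exists_smul_eq_mk_rep K _ hv
  have hP : Projectivization.mk K _ hv ∈ affinePoints K q := by
    refine ⟨?_, fun hP => ?_⟩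
    · change eval _ _ = 0
      rw [← hr, Units.smul_def, eval_curveForm_smul, eval_curveForm]
      simp [h]
    · change _ = _ at hP
      rw [pInfty, Projectivization.mk_eq_mk_iff'] at hP
      obtain ⟨s, hs⟩ := hP
      simpa using congrFun hs 2
  refine ⟨⟨_, hP⟩, ?_, ?_⟩ <;> simp [xCoord, yCoord, affineRep, ← hr, Units.smul_def]

/-- Lines of the affine plane: `x = c` and `y = m x + b`. -/
noncomputable def OnLine (P : affinePoints K q) : K ⊕ K × K → Prop
  | Sum.inl c => xCoord P = c
  | Sum.inr l => yCoord P = l.1 * xCoord P + l.2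

theorem dotProduct_rep_eq_zero_iff (hq : q ≠ 0) (l : Fin 3 → K) (P : affinePoints K q) :
    l ⬝ᵥ P.1.rep = 0 ↔ l 0 * xCoord P + l 1 * yCoord P + l 2 = 0 := by
  rw [rep_eq hq, dotProduct_smul, smul_eq_mul, mul_eq_zero,
    or_iff_right (rep_two_ne_zero hq P)]
  simp [dotProduct, Fin.sum_univ_three]

theorem dotProduct_pInfty_rep_eq_zero_iff (l : Fin 3 → K) :
    l ⬝ᵥ (pInfty K).rep = 0 ↔ l 1 = 0 := by
  have hv : (![0, 1, 0] : Fin 3 → K) ≠ 0 := fun h => one_ne_zero (congrFun h 1)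
  obtain ⟨r, hr⟩ := Projectivization.exists_smul_eq_mk_rep K _ hv
  rw [pInfty, ← hr, Units.smul_def, dotProduct_smul, smul_eq_mul, mul_eq_zero,
    or_iff_right r.ne_zero]
  simp [dotProduct, Fin.sum_univ_three]

theorem vertical_of_linear {l : Fin 3 → K} (hl : l ≠ 0) (h1 : l 1 = 0)
    {S : Set (affinePoints K q)}
    (h : ∀ P ∈ S, l 0 * xCoord P + l 1 * yCoord P + l 2 = 0) :
    ∃ c, ∀ P ∈ S, OnLine P (Sum.inl c) := by
  by_cases h0 : l 0 = 0
  -- Here the line would be `z = 0`, which misses `B`; so `S` is empty and any `c` serves.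
  · refine ⟨0, fun P hP => absurd ?_ hl⟩
    have := h P hP
    ext i
    fin_cases i
    · exact h0
    · exact h1
    · simpa [h0, h1] using this
  · refine ⟨-l 2 / l 0, fun P hP => ?_⟩
    have := h P hP
    rw [h1] at this
    change xCoord P = _
    rw [eq_div_iff h0]
    linear_combination this

theorem isCollinear_iff (hq : q ≠ 0) {S : Set (affinePoints K q)} :
    Projectivization.IsCollinear (Subtype.val '' S) ↔ ∃ l, ∀ P ∈ S, OnLine P l := by
  rw [Projectivization.isCollinear_iff_exists_linear]
  simp only [Set.forall_mem_image, dotProduct_rep_eq_zero_iff hq]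
  constructor
  · rintro ⟨l, hl, h⟩
    by_cases h1 : l 1 = 0
    · obtain ⟨c, hc⟩ := vertical_of_linear hl h1 (fun P hP => h hP)
      exact ⟨_, hc⟩
    · refine ⟨Sum.inr (-l 0 / l 1, -l 2 / l 1), fun P hP => ?_⟩
      have := h hP
      change yCoord P = -l 0 / l 1 * xCoord P + -l 2 / l 1
      field_simp
      linear_combination this
  · rintro ⟨c | ⟨m, b⟩, h⟩
    · refine ⟨![1, 0, -c], fun h0 => one_ne_zero (congrFun h0 0), fun P hP => ?_⟩
      have : xCoord P = c := h P hP
      simp [this]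
    · refine ⟨![m, -1, b], fun h0 => ?_, fun P hP => ?_⟩
      · simpa using congrFun h0 1
      · have : yCoord P = m * xCoord P + b := h P hP
        simp [this]

theorem isCollinear_insert_pInfty_iff (hq : q ≠ 0) {S : Set (affinePoints K q)} :
    Projectivization.IsCollinear (insert (pInfty K) (Subtype.val '' S)) ↔
      ∃ c, ∀ P ∈ S, OnLine P (Sum.inl c) := by
  rw [Projectivization.isCollinear_iff_exists_linear]
  simp only [Set.forall_mem_insert, Set.forall_mem_image, dotProduct_rep_eq_zero_iff hq,
    dotProduct_pInfty_rep_eq_zero_iff]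
  constructor
  · rintro ⟨l, hl, h1, h⟩
    exact vertical_of_linear hl h1 (fun P hP => h hP)
  · rintro ⟨c, h⟩
    refine ⟨![1, 0, -c], fun h0 => one_ne_zero (congrFun h0 0), by simp, fun P hP => ?_⟩
    have : xCoord P = c := h P hP
    simp [this]

/-- Two lines with two points of `B` in common are equal. -/
theorem line_eq_of_onLine (hq : q ≠ 0) {P Q : affinePoints K q} (hPQ : P ≠ Q) {l l' : K ⊕ K × K}
    (hP : OnLine P l) (hQ : OnLine Q l) (hP' : OnLine P l') (hQ' : OnLine Q l') : l = l' := by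
  have hx : ∀ {m b : K}, OnLine P (Sum.inr (m, b)) → OnLine Q (Sum.inr (m, b)) →
      xCoord P ≠ xCoord Q := by
    intro m b h1 h2 h
    have h1 : yCoord P = m * xCoord P + b := h1
    have h2 : yCoord Q = m * xCoord Q + b := h2
    exact hPQ (eq_of_coords_eq hq h (by rw [h1, h2, h]))
  rcases l with c | ⟨m, b⟩ <;> rcases l' with c' | ⟨m', b'⟩
  · exact congrArg Sum.inl (hP.symm.trans hP')
  · exact absurd (hP.trans hQ.symm) (hx hP' hQ')
  · exact absurd (hP'.trans hQ'.symm) (hx hP hQ)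
  · have hne := hx hP hQ
    have h1 : yCoord P = m * xCoord P + b := hP
    have h2 : yCoord Q = m * xCoord Q + b := hQ
    have h3 : yCoord P = m' * xCoord P + b' := hP'
    have h4 : yCoord Q = m' * xCoord Q + b' := hQ'
    have hm : m = m' := by
      apply mul_right_cancel₀ (sub_ne_zero.2 hne)
      linear_combination h2 - h1 + h3 - h4
    subst hm
    have hb : b = b' := by linear_combination h3 - h1
    rw [hb]

theorem exists_line (P Q : affinePoints K q) : ∃ l, OnLine P l ∧ OnLine Q l := by
  by_cases h : xCoord P = xCoord Q
  · exact ⟨Sum.inl (xCoord Q), h, rfl⟩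
  · have h' := sub_ne_zero.2 h
    refine ⟨Sum.inr ((yCoord P - yCoord Q) / (xCoord P - xCoord Q),
      yCoord P - (yCoord P - yCoord Q) / (xCoord P - xCoord Q) * xCoord P), ?_, ?_⟩
    · change yCoord P = (yCoord P - yCoord Q) / (xCoord P - xCoord Q) * xCoord P +
        (yCoord P - (yCoord P - yCoord Q) / (xCoord P - xCoord Q) * xCoord P)
      ring
    · change yCoord Q = (yCoord P - yCoord Q) / (xCoord P - xCoord Q) * xCoord Q +
        (yCoord P - (yCoord P - yCoord Q) / (xCoord P - xCoord Q) * xCoord P)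
      field_simp
      ring

end Points

/-! ### Points of `B` on each line, and counts of collinear subsets -/

section Count

variable {K : Type*} [Field K] [Fintype K] {q : ℕ}

open Classical in
/-- The points of `B` on a line of the affine plane. -/
noncomputable def linePoints (q : ℕ) (l : K ⊕ K × K) : Finset (affinePoints K q) :=
  Finset.univ.filter fun P => OnLine P l

theorem mem_linePoints {l : K ⊕ K × K} {P : affinePoints K q} :
    P ∈ linePoints q l ↔ OnLine P l := by
  simp [linePoints]

/-- Completing the norm: since `m ^ (q ^ 2) = m`, the right-hand power is `(x ^ q - m) * (x - m ^
q)`. The points of a slanted line thus correspond to elements of a given norm. -/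
theorem slanted_equation_iff (hq : IsPrimePow q) (hK : Fintype.card K = q ^ 2) (m b x : K) :
    (m * x + b) ^ q + (m * x + b) = x ^ (q + 1) ↔
      (x - m ^ q) ^ (q + 1) = b ^ q + b + m ^ (q + 1) := by
  rw [add_pow_eq hq hK, pow_succ (x - m ^ q), sub_pow_eq hq hK, pow_sq_eq_self hK, mul_pow,
    pow_succ, pow_succ]
  constructor <;> intro h <;> linear_combination -h

/-- The number of subsets with `k ≥ 2` elements of lines of a given set of lines. -/
theorem ncard_subsets_of_lines (hq : q ≠ 0) {k : ℕ} (hk : 2 ≤ k) (L : Finset (K ⊕ K × K)) :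
    {S : Finset (affinePoints K q) | S.card = k ∧ ∃ l ∈ L, ∀ P ∈ S, OnLine P l}.ncard =
      ∑ l ∈ L, (linePoints q l).card.choose k := by
  classical
  have : {S : Finset (affinePoints K q) | S.card = k ∧ ∃ l ∈ L, ∀ P ∈ S, OnLine P l} =
      ((L.biUnion fun l => (linePoints q l).powersetCard k :
        Finset (Finset (affinePoints K q))) : Set (Finset (affinePoints K q))) := by
    ext S
    simp only [Set.mem_ofPred_eq, Finset.coe_biUnion, Set.mem_iUnion, Finset.mem_coe,
      Finset.mem_powersetCard, Finset.subset_iff, mem_linePoints, exists_prop]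
    exact ⟨fun ⟨h, l, hl, hS⟩ => ⟨l, hl, fun _ => hS _, h⟩,
      fun ⟨l, hl, hS, h⟩ => ⟨h, l, hl, fun _ => @hS _⟩⟩
  rw [this, Set.ncard_coe_finset, Finset.card_biUnion]
  · simp only [Finset.card_powersetCard]
  -- As `k ≥ 2`, a subset lying on two lines would force them to coincide.
  · intro l _ l' _ hll'
    refine Finset.disjoint_left.2 ?_
    intro S hS hS'
    rw [Finset.mem_powersetCard] at hS hS'
    obtain ⟨P, hP, Q, hQ, hPQ⟩ := Finset.one_lt_card.1 (by omega : 1 < S.card)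
    exact hll' (line_eq_of_onLine hq hPQ (mem_linePoints.1 (hS.1 hP))
      (mem_linePoints.1 (hS.1 hQ)) (mem_linePoints.1 (hS'.1 hP)) (mem_linePoints.1 (hS'.1 hQ)))

variable [DecidableEq K]

theorem card_linePoints_inl (hq : IsPrimePow q) (hK : Fintype.card K = q ^ 2) (c : K) :
    (linePoints q (Sum.inl c : K ⊕ K × K)).card = q := by
  have hq0 := hq.pos.ne'
  refine Eq.trans ?_ (card_trace_fiber hq hK (norm_pow_eq hK c))
  refine Finset.card_bij (fun P _ => yCoord P) ?_ ?_ ?_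
  · intro P hP
    have hx : xCoord P = c := mem_linePoints.1 hP
    simp [curve_equation hq0 P, hx]
  · intro P hP Q hQ h
    have hP : xCoord P = c := mem_linePoints.1 hP
    have hQ : xCoord Q = c := mem_linePoints.1 hQ
    exact eq_of_coords_eq hq0 (hP.trans hQ.symm) h
  · intro y hy
    obtain ⟨P, hx, hy⟩ := exists_point (by simpa using hy)
    exact ⟨P, mem_linePoints.2 hx, hy⟩

theorem card_linePoints_inr (hq : IsPrimePow q) (hK : Fintype.card K = q ^ 2) (m b : K) :
    (linePoints q (Sum.inr (m, b) : K ⊕ K × K)).card =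
      (Finset.univ.filter fun u : K => u ^ (q + 1) = b ^ q + b + m ^ (q + 1)).card := by
  have hq0 := hq.pos.ne'
  refine Finset.card_bij (fun P _ => xCoord P - m ^ q) ?_ ?_ ?_
  · intro P hP
    have hy : yCoord P = m * xCoord P + b := mem_linePoints.1 hP
    have h := curve_equation hq0 P
    rw [hy, slanted_equation_iff hq hK] at h
    simpa using h
  · intro P hP Q hQ h
    have hP : yCoord P = m * xCoord P + b := mem_linePoints.1 hP
    have hQ : yCoord Q = m * xCoord Q + b := mem_linePoints.1 hQ
    have hx := sub_left_injective h
    exact eq_of_coords_eq hq0 hx (by rw [hP, hQ, hx])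
  · intro u hu
    have hu : (u + m ^ q - m ^ q) ^ (q + 1) = b ^ q + b + m ^ (q + 1) := by simpa using hu
    rw [← slanted_equation_iff hq hK] at hu
    obtain ⟨P, hx, hy⟩ := exists_point hu
    exact ⟨P, mem_linePoints.2 (by rw [← hx] at hy; exact hy), by rw [hx, add_sub_cancel_right]⟩

theorem card_linePoints_inr_of_eq (hq : IsPrimePow q) (hK : Fintype.card K = q ^ 2) {m b : K}
    (h : b ^ q + b + m ^ (q + 1) = 0) :
    (linePoints q (Sum.inr (m, b) : K ⊕ K × K)).card = 1 := by
  rw [card_linePoints_inr hq hK, h, Finset.card_eq_one]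
  exact ⟨0, by ext; simp⟩

theorem card_linePoints_inr_of_ne (hq : IsPrimePow q) (hK : Fintype.card K = q ^ 2) {m b : K}
    (h : b ^ q + b + m ^ (q + 1) ≠ 0) :
    (linePoints q (Sum.inr (m, b) : K ⊕ K × K)).card = q + 1 := by
  rw [card_linePoints_inr hq hK, card_norm_fiber hq hK _ h]
  rw [add_pow_eq hq hK, trace_pow_eq hq hK, norm_pow_eq hK]

theorem card_tangents (hq : IsPrimePow q) (hK : Fintype.card K = q ^ 2) :
    (Finset.univ.filter fun l : K × K => l.2 ^ q + l.2 + l.1 ^ (q + 1) = 0).card = q ^ 3 := by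
  rw [Finset.card_eq_sum_card_fiberwise (f := Prod.fst) (t := Finset.univ) (by simp)]
  have : ∀ m ∈ (Finset.univ : Finset K),
      ((Finset.univ.filter fun l : K × K => l.2 ^ q + l.2 + l.1 ^ (q + 1) = 0).filter
        fun l => l.1 = m).card = q := by
    intro m _
    refine Eq.trans ?_ (card_trace_fiber hq hK (e := -m ^ (q + 1))
      (by rw [neg_pow_eq hq hK, norm_pow_eq hK]))
    refine Finset.card_bij (fun l _ => l.2) ?_ ?_ ?_
    · intro l hl
      simp only [Finset.mem_filter, Finset.mem_univ, true_and] at hl ⊢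
      rw [← hl.2]
      exact eq_neg_of_add_eq_zero_left hl.1
    · intro l hl l' hl' h
      simp only [Finset.mem_filter] at hl hl'
      exact Prod.ext (hl.2.trans hl'.2.symm) h
    · intro b hb
      simp only [Finset.mem_filter, Finset.mem_univ, true_and] at hb
      exact ⟨(m, b), by simp [hb], rfl⟩
  rw [Finset.sum_congr rfl this, Finset.sum_const, Finset.card_univ, hK, smul_eq_mul]
  ring

theorem card_secants (hq : IsPrimePow q) (hK : Fintype.card K = q ^ 2) :
    (Finset.univ.filter fun l : K × K => ¬ l.2 ^ q + l.2 + l.1 ^ (q + 1) = 0).card =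
      q ^ 4 - q ^ 3 := by
  have h := Finset.card_filter_add_card_filter_not (s := (Finset.univ : Finset (K × K)))
    (fun l : K × K => l.2 ^ q + l.2 + l.1 ^ (q + 1) = 0)
  rw [card_tangents hq hK, Finset.card_univ, Fintype.card_prod, hK] at h
  rw [eq_tsub_iff_add_eq_of_le (Nat.pow_le_pow_right hq.pos (by norm_num)), add_comm, h]
  ring

theorem ncard_vertical_subsets (hq : IsPrimePow q) (hK : Fintype.card K = q ^ 2) {k : ℕ}
    (hk : 2 ≤ k) :
    {S : Finset (affinePoints K q) |
      S.card = k ∧ ∃ c : K, ∀ P ∈ S, OnLine P (Sum.inl c)}.ncard = q ^ 2 * q.choose k := by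
  have h := ncard_subsets_of_lines hq.pos.ne' hk
    (Finset.univ.map ⟨(Sum.inl : K → K ⊕ K × K), Sum.inl_injective⟩)
  simp only [Finset.mem_map, Finset.mem_univ, true_and, Function.Embedding.coeFn_mk,
    exists_exists_eq_and, Finset.sum_map, card_linePoints_inl hq hK, Finset.sum_const,
    Finset.card_univ, hK, smul_eq_mul] at h
  exact h

theorem ncard_collinear_subsets (hq : IsPrimePow q) (hK : Fintype.card K = q ^ 2) {k : ℕ}
    (hk : 2 < k) :
    {S : Finset (affinePoints K q) |
      S.card = k ∧ ∃ l : K ⊕ K × K, ∀ P ∈ S, OnLine P l}.ncard =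
        q ^ 2 * q.choose k + (q ^ 4 - q ^ 3) * (q + 1).choose k := by
  have h := ncard_subsets_of_lines hq.pos.ne' hk.le (Finset.univ : Finset (K ⊕ K × K))
  simp only [Finset.mem_univ, true_and] at h
  rw [h, Fintype.sum_sum_type]
  congr 1
  · simp only [card_linePoints_inl hq hK, Finset.sum_const, Finset.card_univ, hK, smul_eq_mul]
  · rw [← Finset.sum_filter_add_sum_filter_not Finset.univ
      (fun l : K × K => l.2 ^ q + l.2 + l.1 ^ (q + 1) = 0), Finset.sum_eq_zero, zero_add,
      Finset.sum_congr rfl (g := fun _ => (q + 1).choose k), Finset.sum_const, smul_eq_mul,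
      card_secants hq hK]
    · rintro ⟨m, b⟩ hl
      rw [card_linePoints_inr_of_ne hq hK (Finset.mem_filter.1 hl).2]
    · rintro ⟨m, b⟩ hl
      rw [card_linePoints_inr_of_eq hq hK (Finset.mem_filter.1 hl).2]
      -- A tangent carries a single point of `B`, so it contributes no `k`-subset.
      exact Nat.choose_eq_zero_of_lt (by omega)

/-- Supplies `d + 2` collinear points: for `d = q - 1` a vertical line, with its `q` points, is too
short. -/
theorem exists_secant (hq : IsPrimePow q) (hK : Fintype.card K = q ^ 2) :
    ∃ l : K ⊕ K × K, (linePoints q l).card = q + 1 := by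
  have h := card_secants (K := K) hq hK
  have hlt : q ^ 3 < q ^ 4 := Nat.pow_lt_pow_right hq.two_le (by norm_num)
  obtain ⟨⟨m, b⟩, hl⟩ := Finset.card_pos.1 (by rw [h]; omega)
  exact ⟨_, card_linePoints_inr_of_ne hq hK (Finset.mem_filter.1 hl).2⟩

end Count

end Hermitian

namespace Hermitian

open MvPolynomial

/-! ### Forms vanishing on `a • P_∞` -/

section Sections

variable {K : Type*} [Field K] {q : ℕ}

theorem toChart_eq (f : MvPolynomial (Fin 3) K) :
    toChart K q f = Ideal.Quotient.mk _ (dehomog K f) := rfl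

theorem toChart_X_zero_mem : toChart K q (X 0) ∈ idealPInfty K q := by
  simp only [toChart_eq, dehomog, aeval_X]
  exact Ideal.subset_span (Or.inl rfl)

/-- In the chart `y = 1` the curve reads `z = x ^ (q + 1) - z ^ q`, and both terms lie in the `q`-th
power of the ideal. -/
theorem toChart_X_two_mem_pow : toChart K q (X 2) ∈ idealPInfty K q ^ q := by
  have hz : toChart K q (X 2) ∈ idealPInfty K q := by
    simp only [toChart_eq, dehomog, aeval_X]
    exact Ideal.subset_span (Or.inr rfl)
  have hrel : toChart K q (curveForm K q) = 0 := by
    rw [toChart_eq, Ideal.Quotient.eq_zero_iff_mem]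
    exact Ideal.subset_span rfl
  have h1 : toChart K q (X 1) = 1 := by
    have : dehomog K (X 1) = 1 := by simp [dehomog]
    rw [toChart_eq, this]
    exact map_one _
  simp only [curveForm, map_sub, map_add, map_mul, map_pow, h1, one_pow, one_mul] at hrel
  have hx : toChart K q (X 0) ^ (q + 1) ∈ idealPInfty K q ^ q :=
    Ideal.pow_le_pow_right (Nat.le_succ q) (Ideal.pow_mem_pow toChart_X_zero_mem _)
  have : toChart K q (X 2) = toChart K q (X 0) ^ (q + 1) - toChart K q (X 2) ^ q := by
    linear_combination hrel
  rw [this]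
  exact sub_mem hx (Ideal.pow_mem_pow hz _)

theorem mem_sections {d a : ℕ} {f : MvPolynomial (Fin 3) K} :
    f ∈ sections K q d a ↔ f.IsHomogeneous d ∧ toChart K q f ∈ idealPInfty K q ^ a := Iff.rfl

theorem mem_sections_zero {d : ℕ} {f : MvPolynomial (Fin 3) K} (hf : f.IsHomogeneous d) :
    f ∈ sections K q d 0 := by
  simp [mem_sections, hf]

/-- Since `z = 1` on `B`, the factor leaves the values unchanged; vanishing on `a • P_∞` costs just
one degree. -/
theorem mul_X_two_mem_sections {e a : ℕ} (ha : a ≤ q)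
    {f : MvPolynomial (Fin 3) K} (hf : f.IsHomogeneous e) :
    f * X 2 ∈ sections K q (e + 1) a := by
  refine ⟨hf.mul (isHomogeneous_X K 2), ?_⟩
  change toChart K q (f * X 2) ∈ idealPInfty K q ^ a
  rw [map_mul]
  exact Ideal.mul_mem_left _ _ (Ideal.pow_le_pow_right ha (toChart_X_two_mem_pow))

/-- Each vertical line passes through `P_∞`, so each factor lies in the ideal of that point. -/
theorem prod_vertical_mem_sections {ι : Type*} (hq : 1 ≤ q) {a : ℕ} (T : Finset ι) (c : ι → K)
    (ha : a ≤ T.card) : ∏ i ∈ T, (X 0 - C (c i) * X 2) ∈ sections K q T.card a := by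
  refine ⟨?_, ?_⟩
  · have := IsHomogeneous.prod T (fun i => (X 0 - C (c i) * X 2 : MvPolynomial (Fin 3) K))
      (fun _ => 1) (fun i _ => (isHomogeneous_X K 0).sub ((isHomogeneous_X K 2).C_mul _))
    simpa using this
  · refine Ideal.pow_le_pow_right ha ?_
    change toChart K q _ ∈ _
    rw [map_prod]
    suffices h : ∀ i ∈ T, toChart K q (X 0 - C (c i) * X 2) ∈ idealPInfty K q by
      simpa only [Finset.prod_const] using Ideal.prod_mem_prod h
    intro i _
    rw [map_sub, map_mul]
    refine sub_mem toChart_X_zero_mem (Ideal.mul_mem_left _ _ ?_)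
    exact Ideal.pow_le_self (Nat.one_le_iff_ne_zero.1 hq) (toChart_X_two_mem_pow)

theorem eval_pInfty_eq_zero (hq : q ≠ 0) {d a : ℕ} (ha : 0 < a) {f : MvPolynomial (Fin 3) K}
    (hf : f ∈ sections K q d a) : eval ![0, 1, 0] f = 0 := by
  have hmem : toChart K q f ∈ idealPInfty K q := Ideal.pow_le_self ha.ne' hf.2
  have hcomp : ∀ g : MvPolynomial (Fin 3) K,
      eval (![0, 0] : Fin 2 → K) (dehomog K g) = eval ![0, 1, 0] g := by
    intro g
    have : ((aeval (![0, 0] : Fin 2 → K)).comp (dehomog K)) =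
        (aeval (![0, 1, 0] : Fin 3 → K) : MvPolynomial (Fin 3) K →ₐ[K] K) := by
      ext i
      fin_cases i <;> simp [dehomog]
    exact DFunLike.congr_fun this g
  -- Evaluation at the origin of the chart descends to the coordinate ring, because the curve passes
  -- through the origin; it kills `idealPInfty`.
  let ψ : ChartRing K q →+* K := Ideal.Quotient.lift _ (eval (![0, 0] : Fin 2 → K)) (by
    intro g hg
    obtain ⟨h, rfl⟩ := Ideal.mem_span_singleton.1 hg
    rw [map_mul, hcomp, eval_curveForm]
    simp [hq])
  have hle : idealPInfty K q ≤ RingHom.ker ψ := by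
    refine Ideal.span_le.2 ?_
    rintro _ (rfl | rfl) <;> simp [ψ]
  have h0 : ψ (toChart K q f) = 0 := hle hmem
  rw [toChart_eq, Ideal.Quotient.lift_mk, hcomp] at h0
  exact h0

/-- A form of degree `d` restricted to the line `u + t v`. -/
noncomputable def restrictLine (u v : Fin 3 → K) (f : MvPolynomial (Fin 3) K) : Polynomial K :=
  aeval (fun i => Polynomial.C (u i) + Polynomial.C (v i) * Polynomial.X) f

theorem eval_restrictLine (u v : Fin 3 → K) (f : MvPolynomial (Fin 3) K) (t : K) :
    (restrictLine u v f).eval t = eval (u + t • v) f := by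
  have : ((Polynomial.aeval t).comp
      (aeval (fun i => Polynomial.C (u i) + Polynomial.C (v i) * Polynomial.X))) =
      (aeval (u + t • v) : MvPolynomial (Fin 3) K →ₐ[K] K) := by
    ext i
    simp
    ring
  exact DFunLike.congr_fun this f

theorem natDegree_restrictLine_monomial (u v : Fin 3 → K) (s : Fin 3 →₀ ℕ) (r : K) :
    (restrictLine u v (monomial s r)).natDegree ≤ s.degree ∧
      (restrictLine u v (monomial s r)).coeff s.degree = eval v (monomial s r) := by
  have hlin : ∀ i, (Polynomial.C (u i) + Polynomial.C (v i) * Polynomial.X).natDegree ≤ 1 := by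
    intro i
    rw [add_comm]
    exact Polynomial.natDegree_linear_le
  have hpow : ∀ i, ((Polynomial.C (u i) + Polynomial.C (v i) * Polynomial.X) ^ s i).natDegree
      ≤ s i := fun i => by
    simpa using Polynomial.natDegree_pow_le_of_le (s i) (hlin i)
  have hcoeff : ∀ i, ((Polynomial.C (u i) + Polynomial.C (v i) * Polynomial.X) ^ s i).coeff (s i)
      = v i ^ s i := fun i => by
    have := Polynomial.coeff_pow_of_natDegree_le (hlin i) (m := s i)
    rw [mul_one] at this
    simpa using this
  have hdeg : s.degree = ∑ i, s i := by
    rw [Finsupp.degree_eq_sum]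
  rw [restrictLine, aeval_monomial, Finsupp.prod_fintype _ _ (by simp), eval_monomial,
    Finsupp.prod_fintype _ _ (by simp), hdeg, Polynomial.algebraMap_eq]
  constructor
  · refine (Polynomial.natDegree_C_mul_le _ _).trans ((Polynomial.natDegree_prod_le _ _).trans ?_)
    exact Finset.sum_le_sum fun i _ => hpow i
  · rw [Polynomial.coeff_C_mul, Fin.sum_univ_three, Fin.prod_univ_three, Fin.prod_univ_three,
      Polynomial.coeff_mul_add_eq_of_natDegree_le ?_ (hpow 2),
      Polynomial.coeff_mul_add_eq_of_natDegree_le (hpow 0) (hpow 1), hcoeff, hcoeff, hcoeff]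
    exact Polynomial.natDegree_mul_le_of_le (hpow 0) (hpow 1)

/-- The direction `v` is the point of the line at `t = ∞`; vanishing there lowers the degree by one,
which is the gain on lines through `P_∞`. -/
theorem natDegree_restrictLine (u v : Fin 3 → K) {d : ℕ} {f : MvPolynomial (Fin 3) K}
    (hf : f.IsHomogeneous d) :
    (restrictLine u v f).natDegree ≤ d ∧ (restrictLine u v f).coeff d = eval v f := by
  have hsum : restrictLine u v f = ∑ s ∈ f.support, restrictLine u v (monomial s (f.coeff s)) := by
    conv_lhs => rw [f.as_sum]
    exact map_sum (aeval _) _ _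
  have hd : ∀ s ∈ f.support, s.degree = d := fun s hs => by
    rw [Finsupp.degree_eq_weight_one]
    exact hf (mem_support_iff.1 hs)
  constructor
  · rw [hsum]
    refine Polynomial.natDegree_sum_le_of_forall_le _ _ fun s hs => ?_
    rw [← hd s hs]
    exact (natDegree_restrictLine_monomial u v s _).1
  · rw [hsum, Polynomial.finsetSum_coeff]
    conv_rhs => rw [f.as_sum, map_sum]
    refine Finset.sum_congr rfl fun s hs => ?_
    rw [← hd s hs]
    exact (natDegree_restrictLine_monomial u v s _).2

end Sections

/-! ### The codes `C(d, a)` and their duals -/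

section Code

variable {K : Type*} [Field K] {q : ℕ}

/-- The value of a form at a point of `B`. -/
theorem evalMap_apply (hq : q ≠ 0) (f : MvPolynomial (Fin 3) K) (P : affinePoints K q) :
    evalMap K q f P = eval ![xCoord P, yCoord P, 1] f := by
  rw [← affineRep_eq hq]
  rfl

theorem exists_linear_form_onLine (l : K ⊕ K × K) :
    ∃ f : MvPolynomial (Fin 3) K, f.IsHomogeneous 1 ∧
      ∀ P : affinePoints K q, eval ![xCoord P, yCoord P, 1] f = 0 ↔ OnLine P l := by
  rcases l with c | ⟨m, b⟩
  · refine ⟨X 0 - C c * X 2, (isHomogeneous_X K 0).sub ((isHomogeneous_X K 2).C_mul _), ?_⟩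
    intro P
    simp [OnLine, sub_eq_zero]
  · refine ⟨X 1 - C m * X 0 - C b * X 2, ((isHomogeneous_X K 1).sub
      ((isHomogeneous_X K 0).C_mul _)).sub ((isHomogeneous_X K 2).C_mul _), ?_⟩
    intro P
    simp [OnLine, sub_eq_zero, sub_sub]

theorem exists_line_notMem (hq : q ≠ 0) {P Q : affinePoints K q} (hPQ : P ≠ Q) :
    ∃ l, OnLine Q l ∧ ¬ OnLine P l := by
  by_cases hx : xCoord P = xCoord Q
  · refine ⟨Sum.inr (0, yCoord Q), by simp [OnLine], fun h => hPQ (eq_of_coords_eq hq hx ?_)⟩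
    simpa [OnLine] using h
  · exact ⟨Sum.inl (xCoord Q), rfl, hx⟩

/-- At most `e` points of `B` can be separated from another one by a form of degree `e`. -/
theorem exists_form_of_card_le (hq : q ≠ 0) {P : affinePoints K q}
    {T : Finset (affinePoints K q)} (hP : P ∉ T) {e : ℕ} (he : T.card ≤ e) :
    ∃ f : MvPolynomial (Fin 3) K, f.IsHomogeneous e ∧
      eval ![xCoord P, yCoord P, 1] f ≠ 0 ∧
      ∀ Q ∈ T, eval ![xCoord Q, yCoord Q, 1] f = 0 := by
  have h : ∀ Q ∈ T, ∃ f : MvPolynomial (Fin 3) K, f.IsHomogeneous 1 ∧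
      eval ![xCoord P, yCoord P, 1] f ≠ 0 ∧ eval ![xCoord Q, yCoord Q, 1] f = 0 := by
    intro Q hQ
    obtain ⟨l, hl, hl'⟩ := exists_line_notMem hq (show P ≠ Q from fun h => hP (h ▸ hQ))
    obtain ⟨f, hf, hf'⟩ := exists_linear_form_onLine (q := q) l
    exact ⟨f, hf, fun h0 => hl' ((hf' P).1 h0), (hf' Q).2 hl⟩
  choose! g hg1 hgP hgQ using h
  -- The power of `z` pads the degree to exactly `e` and equals `1` on `B`.
  refine ⟨(∏ Q ∈ T, g Q) * X 2 ^ (e - T.card), ?_, ?_, ?_⟩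
  · have h1 := IsHomogeneous.prod T g (fun _ => 1) hg1
    have h2 := h1.mul ((isHomogeneous_X K (2 : Fin 3)).pow (e - T.card))
    simpa [Nat.add_sub_cancel' he] using h2
  · simp only [map_mul, map_prod, map_pow, eval_X]
    simpa using Finset.prod_ne_zero_iff.2 hgP
  · intro Q hQ
    rw [map_mul, map_prod, Finset.prod_eq_zero hQ (hgQ Q hQ), zero_mul]

/-- In a non-collinear set of `e + 2` points of `B`, some point is separated from the others by a
form of degree `e`. -/
theorem exists_form_of_not_collinear (hq : q ≠ 0) {S : Finset (affinePoints K q)} {e : ℕ}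
    (he : S.card ≤ e + 2) (hS : ¬ ∃ l, ∀ P ∈ S, OnLine P l) :
    ∃ f : MvPolynomial (Fin 3) K, f.IsHomogeneous e ∧
      ∃ P ∈ S, eval ![xCoord P, yCoord P, 1] f ≠ 0 ∧
        ∀ Q ∈ S, Q ≠ P → eval ![xCoord Q, yCoord Q, 1] f = 0 := by
  classical
  have hcard : 1 < S.card := by
    by_contra! hle
    apply hS
    rcases S.eq_empty_or_nonempty with rfl | ⟨P, hP⟩
    · exact ⟨Sum.inl 0, by simp⟩
    · exact ⟨Sum.inl (xCoord P), fun Q hQ => by rw [Finset.card_le_one.1 hle Q hQ P hP]; rfl⟩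
  -- The line through `Q` and `R` handles both with one linear factor; the at most `e - 1` other
  -- points besides `P` get one factor each.
  obtain ⟨Q, hQ, R, hR, hQR⟩ := Finset.one_lt_card.1 hcard
  obtain ⟨l, hlQ, hlR⟩ := exists_line Q R
  push Not at hS
  obtain ⟨P, hP, hlP⟩ := hS l
  have hPQ : P ≠ Q := fun h => hlP (h ▸ hlQ)
  have hPR : P ≠ R := fun h => hlP (h ▸ hlR)
  have h3 : (((S.erase P).erase Q).erase R).card + 3 = S.card := by
    have h1 := Finset.card_erase_add_one hP
    have h2 := Finset.card_erase_add_one (Finset.mem_erase.2 ⟨hPQ.symm, hQ⟩)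
    have h3 := Finset.card_erase_add_one
      (Finset.mem_erase.2 ⟨hQR.symm, Finset.mem_erase.2 ⟨hPR.symm, hR⟩⟩)
    omega
  obtain ⟨k, rfl⟩ : ∃ k, e = k + 1 := ⟨e - 1, by omega⟩
  obtain ⟨f, hf, hfP, hf0⟩ := exists_form_of_card_le hq (P := P)
    (T := ((S.erase P).erase Q).erase R) (by simp) (e := k) (by omega)
  obtain ⟨g, hg, hg0⟩ := exists_linear_form_onLine (q := q) l
  refine ⟨f * g, hf.mul hg, P, hP, ?_, ?_⟩
  · rw [map_mul]
    exact mul_ne_zero hfP (fun h => hlP ((hg0 P).1 h))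
  · intro Z hZ hZP
    rw [map_mul]
    by_cases hlZ : OnLine Z l
    · rw [(hg0 Z).2 hlZ, mul_zero]
    · have hZQ : Z ≠ Q := fun h => hlZ (h ▸ hlQ)
      have hZR : Z ≠ R := fun h => hlZ (h ▸ hlR)
      rw [hf0 Z (by simp [hZ, hZP, hZQ, hZR]), zero_mul]

variable [Fintype K]

theorem notMem_dual_of_form (hq : q ≠ 0) {d a : ℕ} {v : affinePoints K q → K}
    {f : MvPolynomial (Fin 3) K} (hf : f ∈ sections K q d a) {P : affinePoints K q}
    (hvP : v P ≠ 0) (hP : eval ![xCoord P, yCoord P, 1] f ≠ 0)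
    (h : ∀ Q, Q ≠ P → v Q ≠ 0 → eval ![xCoord Q, yCoord Q, 1] f = 0) :
    v ∉ LinCode.dual (code K q d a) := by
  refine LinCode.notMem_dual (Submodule.mem_map_of_mem (f := evalMap K q) hf) hvP ?_ ?_
  · rwa [evalMap_apply hq]
  · intro Q hQ hvQ
    rw [evalMap_apply hq]
    exact h Q hQ hvQ

/-- If all forms of degree `e`, multiplied by a fixed power of `z`, belong to the sections, then
the dual code has minimum distance at least `e + 2`. -/
theorem lt_hammingNorm_of_mem_dual [DecidableEq K] (hq : q ≠ 0) {d a e k : ℕ}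
    (hsec : ∀ f : MvPolynomial (Fin 3) K, f.IsHomogeneous e → f * X 2 ^ k ∈ sections K q d a)
    {v : affinePoints K q → K} (hv : v ∈ LinCode.dual (code K q d a)) (hv0 : v ≠ 0) :
    e + 2 ≤ hammingNorm v := by
  classical
  by_contra! hlt
  obtain ⟨P, hP⟩ := Function.ne_iff.1 hv0
  have hP : v P ≠ 0 := hP
  set T := (Finset.univ.filter fun i => v i ≠ 0 : Finset (affinePoints K q)).erase P with hT
  have hcard : T.card + 1 = hammingNorm v :=
    Finset.card_erase_add_one (by simpa using hP)
  obtain ⟨f, hf, hfP, hf0⟩ := exists_form_of_card_le hq (P := P) (T := T)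
    (Finset.notMem_erase _ _) (e := e) (by omega)
  refine notMem_dual_of_form hq (hsec f hf) hP ?_ ?_ hv
  · simpa using hfP
  · intro Q hQP hQ
    rw [map_mul, hf0 Q (by simp [hT, hQP, hQ]), zero_mul]

theorem collinear_of_mem_dual (hq : q ≠ 0) {d a e k : ℕ}
    (hsec : ∀ f : MvPolynomial (Fin 3) K, f.IsHomogeneous e → f * X 2 ^ k ∈ sections K q d a)
    {v : affinePoints K q → K} (hv : v ∈ LinCode.dual (code K q d a))
    {S : Finset (affinePoints K q)} (hS : Function.support v = (S : Set (affinePoints K q)))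
    (hcard : S.card ≤ e + 2) : ∃ l, ∀ P ∈ S, OnLine P l := by
  by_contra hcol
  have hmem : ∀ P, v P ≠ 0 ↔ P ∈ S := fun P => Set.ext_iff.1 hS P
  obtain ⟨f, hf, P, hP, hfP, hf0⟩ := exists_form_of_not_collinear hq hcard hcol
  refine notMem_dual_of_form hq (hsec f hf) ((hmem P).2 hP) ?_ ?_ hv
  · simpa using hfP
  · intro Q hQP hQ
    rw [map_mul, hf0 Q ((hmem Q).1 hQ) hQP, zero_mul]

/-- A codeword of the dual of `C(d, a)` supported on `d + 1` points of a line has its support on a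
line through `P_∞`. -/
theorem vertical_of_mem_dual (hq : 1 ≤ q) {d a : ℕ} (had : a ≤ d)
    {v : affinePoints K q → K} (hv : v ∈ LinCode.dual (code K q d a))
    {S : Finset (affinePoints K q)} (hS : Function.support v = (S : Set (affinePoints K q)))
    (hcard : S.card = d + 1) {l : K ⊕ K × K} (hl : ∀ P ∈ S, OnLine P l) :
    ∃ c, ∀ P ∈ S, OnLine P (Sum.inl c) := by
  classical
  have hq0 : q ≠ 0 := by omega
  have hmem : ∀ P, v P ≠ 0 ↔ P ∈ S := fun P => Set.ext_iff.1 hS P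
  rcases l with c | ⟨m, b⟩
  · exact ⟨c, hl⟩
  exfalso
  obtain ⟨P, hP⟩ := Finset.card_pos.1 (by omega : 0 < S.card)
  have hTc : (S.erase P).card = d := by
    rw [Finset.card_erase_of_mem hP, hcard, Nat.add_sub_cancel]
  -- Distinct points of a slanted line have distinct `x`, so the vertical lines through the other
  -- `d` points all miss `P`.
  have hsec := prod_vertical_mem_sections hq (S.erase P) xCoord (had.trans hTc.ge)
  rw [hTc] at hsec
  refine notMem_dual_of_form hq0 hsec ((hmem P).2 hP) ?_ ?_ hv
  · rw [map_prod]
    refine Finset.prod_ne_zero_iff.2 fun Q hQ => ?_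
    obtain ⟨hQP, hQS⟩ := Finset.mem_erase.1 hQ
    have h1 : yCoord P = m * xCoord P + b := hl P hP
    have h2 : yCoord Q = m * xCoord Q + b := hl Q hQS
    have hx : xCoord P ≠ xCoord Q := fun h => hQP (eq_of_coords_eq hq0 h.symm (by rw [h1, h2, h]))
    simpa using sub_ne_zero.2 hx
  · intro Q hQP hvQ
    rw [map_prod]
    exact Finset.prod_eq_zero (Finset.mem_erase.2 ⟨hQP, (hmem Q).1 hvQ⟩) (by simp)

/-- A set of `d + 2` points of the line `u + t w` is the support of a codeword of the dual, and so
is a set of `d + 1` points if all sections vanish at the point `w` of the line. -/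
theorem exists_mem_dual_of_param (hq : q ≠ 0) {d a : ℕ} {u w : Fin 3 → K}
    {S : Finset (affinePoints K q)} {t : affinePoints K q → K} (ht : Set.InjOn t S)
    (hline : ∀ P ∈ S, (![xCoord P, yCoord P, 1] : Fin 3 → K) = u + t P • w)
    (hcard : S.card = d + 2 ∨
      S.card = d + 1 ∧ ∀ f ∈ sections K q d a, eval w f = 0) :
    ∃ v ∈ LinCode.dual (code K q d a), Function.support v = (S : Set (affinePoints K q)) := by
  refine LinCode.exists_mem_dual_support_eq ht ?_
  rintro _ ⟨f, hf, rfl⟩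
  obtain ⟨hdeg, hcoeff⟩ := natDegree_restrictLine u w hf.1
  refine ⟨restrictLine u w f, ?_, ?_, fun P hP => ?_⟩
  · refine Polynomial.degree_le_natDegree.trans_lt ?_
    exact_mod_cast (by omega : (restrictLine u w f).natDegree < S.card)
  -- The coefficient in question has degree `d + 1` in the first case, beyond the degree of the
  -- form; in the second it has degree `d` and is the value at `w`.
  · rcases hcard with h | ⟨h, h0⟩
    · exact Polynomial.coeff_eq_zero_of_natDegree_lt (by omega)
    · rw [h, Nat.add_sub_cancel, hcoeff, h0 f hf]
  · rw [eval_restrictLine, evalMap_apply hq, hline P hP]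

theorem exists_mem_dual_of_vertical (hq : q ≠ 0) {d a : ℕ} {S : Finset (affinePoints K q)}
    {c : K} (hS : ∀ P ∈ S, OnLine P (Sum.inl c)) (hcard : S.card = d + 2 ∨ S.card = d + 1 ∧ 0 < a) :
    ∃ v ∈ LinCode.dual (code K q d a), Function.support v = (S : Set (affinePoints K q)) := by
  have hS : ∀ P ∈ S, xCoord P = c := hS
  refine exists_mem_dual_of_param hq (t := yCoord) (u := ![c, 0, 1]) (w := ![0, 1, 0])
    (fun P hP Q hQ h => eq_of_coords_eq hq ((hS P hP).trans (hS Q hQ).symm) h) ?_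
    (hcard.imp_right fun h => ⟨h.1, fun f hf => eval_pInfty_eq_zero hq h.2 hf⟩)
  intro P hP
  ext i
  fin_cases i <;> simp [hS P hP]

theorem exists_mem_dual_of_collinear (hq : q ≠ 0) {d a : ℕ} {S : Finset (affinePoints K q)}
    {l : K ⊕ K × K} (hS : ∀ P ∈ S, OnLine P l) (hcard : S.card = d + 2) :
    ∃ v ∈ LinCode.dual (code K q d a), Function.support v = (S : Set (affinePoints K q)) := by
  rcases l with c | ⟨m, b⟩
  · exact exists_mem_dual_of_vertical hq hS (Or.inl hcard)
  have hS : ∀ P ∈ S, yCoord P = m * xCoord P + b := hS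
  refine exists_mem_dual_of_param hq (t := xCoord) (u := ![0, b, 1]) (w := ![1, m, 0])
    (fun P hP Q hQ h => eq_of_coords_eq hq h ?_) ?_ (Or.inl hcard)
  · rw [hS P hP, hS Q hQ, h]
  · intro P hP
    ext i
    fin_cases i <;> simp [hS P hP]
    ring

end Code

end Hermitian

/-! ### The theorem: both cases assembled -/

theorem theorem4p1 {K : Type*} [Field K] [Fintype K] [DecidableEq K]
    (q : ℕ) (hq : IsPrimePow q) (hK : Fintype.card K = q ^ 2)
    (d a : ℕ) (hd : 1 ≤ d) (hdq : d ≤ q - 1) (had : a ≤ d) :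
    (a = 0 →
      LinCode.minDist (LinCode.dual (Hermitian.code K q d a)) = ((d + 2 : ℕ) : ℕ∞) ∧
      (∀ S : Finset (Hermitian.affinePoints K q),
        LinCode.IsMinWeightSupport (LinCode.dual (Hermitian.code K q d a)) S ↔
          S.card = d + 2 ∧
            Projectivization.IsCollinear (Subtype.val '' (S : Set (Hermitian.affinePoints K q)))) ∧
      (LinCode.numMinWeight (LinCode.dual (Hermitian.code K q d a)) : ℚ) / ((q : ℚ) ^ 2 - 1) =
        if d = q - 1 then (q : ℚ) ^ 4 - (q : ℚ) ^ 3
        else (q : ℚ) ^ 2 * (q.choose (d + 2) : ℚ) +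
          ((q : ℚ) ^ 4 - (q : ℚ) ^ 3) * ((q + 1).choose (d + 2) : ℚ)) ∧
    (0 < a →
      LinCode.minDist (LinCode.dual (Hermitian.code K q d a)) = ((d + 1 : ℕ) : ℕ∞) ∧
      (∀ S : Finset (Hermitian.affinePoints K q),
        LinCode.IsMinWeightSupport (LinCode.dual (Hermitian.code K q d a)) S ↔
          S.card = d + 1 ∧
            Projectivization.IsCollinear
              (insert (Hermitian.pInfty K)
                (Subtype.val '' (S : Set (Hermitian.affinePoints K q))))) ∧
      (LinCode.numMinWeight (LinCode.dual (Hermitian.code K q d a)) : ℚ) / ((q : ℚ) ^ 2 - 1) =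
        (q : ℚ) ^ 2 * (q.choose (d + 1) : ℚ)) := by
  have hq2 := hq.two_le
  have hq0 : q ≠ 0 := by omega
  have hcardK : ((Fintype.card K - 1 : ℕ) : ℚ) = (q : ℚ) ^ 2 - 1 := by
    rw [hK, Nat.cast_sub (Nat.one_le_pow _ _ (by omega))]
    push_cast
    ring
  have hne : (q : ℚ) ^ 2 - 1 ≠ 0 := by
    have : (2 : ℚ) ≤ q := by exact_mod_cast hq2
    nlinarith
  constructor
  · rintro rfl
    have hsec : ∀ f : MvPolynomial (Fin 3) K, f.IsHomogeneous d →
        f * MvPolynomial.X 2 ^ 0 ∈ Hermitian.sections K q d 0 := fun f hf => by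
      rw [pow_zero, mul_one]
      exact Hermitian.mem_sections_zero hf
    obtain ⟨hmin, hsupp⟩ := LinCode.minDist_and_isMinWeightSupport
      (D := LinCode.dual (Hermitian.code K q d 0)) (δ := d + 2) (by omega)
      (p := fun S => ∃ l, ∀ P ∈ S, Hermitian.OnLine P l)
      (fun v hv hv0 => Hermitian.lt_hammingNorm_of_mem_dual hq0 hsec hv hv0)
      (fun v hv S hS hc => Hermitian.collinear_of_mem_dual hq0 hsec hv hS hc.le)
      (fun S hc ⟨l, hl⟩ => Hermitian.exists_mem_dual_of_collinear hq0 hl hc)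
      (by
        obtain ⟨l, hl⟩ := Hermitian.exists_secant (K := K) hq hK
        obtain ⟨S, hS, hc⟩ := Finset.exists_subset_card_eq
          (show d + 2 ≤ (Hermitian.linePoints q l).card by omega)
        exact ⟨S, hc, l, fun P hP => Hermitian.mem_linePoints.1 (hS hP)⟩)
    refine ⟨hmin, fun S => ?_, ?_⟩
    · rw [hsupp, Hermitian.isCollinear_iff hq0]
      rfl
    · rw [LinCode.numMinWeight_eq_mul, Nat.cast_mul, hcardK, mul_div_assoc, div_self hne, mul_one]
      simp only [hsupp]
      rw [Hermitian.ncard_collinear_subsets hq hK (by omega)]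
      have hle : q ^ 3 ≤ q ^ 4 := Nat.pow_le_pow_right (by omega) (by norm_num)
      push_cast [Nat.cast_sub hle]
      split_ifs with h
      -- For `d = q - 1` vertical lines are too short and each secant gives one support, the set of
      -- all its `q + 1` points.
      · rw [show d + 2 = q + 1 by omega, Nat.choose_self, Nat.choose_succ_self]
        simp
      · rfl
  · intro ha
    have hsec : ∀ e, e + 1 = d → ∀ f : MvPolynomial (Fin 3) K, f.IsHomogeneous e →
        f * MvPolynomial.X 2 ^ 1 ∈ Hermitian.sections K q d a := by
      rintro e rfl f hf
      rw [pow_one]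
      exact Hermitian.mul_X_two_mem_sections (by omega) hf
    -- One degree is spent on the factor `z`, so the general bound `e + 2` reads `d + 1`.
    obtain ⟨e, rfl⟩ : ∃ e, d = e + 1 := ⟨d - 1, by omega⟩
    obtain ⟨hmin, hsupp⟩ := LinCode.minDist_and_isMinWeightSupport
      (D := LinCode.dual (Hermitian.code K q (e + 1) a)) (δ := e + 1 + 1) (by omega)
      (p := fun S => ∃ c, ∀ P ∈ S, Hermitian.OnLine P (Sum.inl c))
      (fun v hv hv0 => Hermitian.lt_hammingNorm_of_mem_dual hq0 (hsec e rfl) hv hv0)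
      (fun v hv S hS hc => by
        obtain ⟨l, hl⟩ := Hermitian.collinear_of_mem_dual hq0 (hsec e rfl) hv hS hc.le
        exact Hermitian.vertical_of_mem_dual (by omega) had hv hS hc hl)
      (fun S hc ⟨c, hl⟩ => Hermitian.exists_mem_dual_of_vertical hq0 hl (Or.inr ⟨hc, ha⟩))
      (by
        obtain ⟨S, hS, hc⟩ := Finset.exists_subset_card_eq
          (show e + 1 + 1 ≤ (Hermitian.linePoints q (Sum.inl (0 : K))).card by
            rw [Hermitian.card_linePoints_inl hq hK]; omega)
        exact ⟨S, hc, 0, fun P hP => Hermitian.mem_linePoints.1 (hS hP)⟩)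
    refine ⟨hmin, fun S => ?_, ?_⟩
    · rw [hsupp, Hermitian.isCollinear_insert_pInfty_iff hq0]
      rfl
    · rw [LinCode.numMinWeight_eq_mul, Nat.cast_mul, hcardK, mul_div_assoc, div_self hne, mul_one]
      simp only [hsupp]
      rw [Hermitian.ncard_vertical_subsets hq hK (by omega)]
      push_cast
      rfl
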